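/- Let $(\Omega,\mathcal F,\mathbb P)$ be a probability space and let $(\tau_x)_{x\in\mathbb R}$ be maps $\Omega\to\Omega$ with $\tau_0=\mathrm{id}$ and $\tau_{x+y}=\tau_x\circ\tau_y$, such that each $\tau_x$ is measurable and preserves $\mathbb P$. Assume that the action is ergodic: every measurable $\varphi:\Omega\to\mathbb R$ such that, for each fixed $x\in\mathbb R$, $\varphi(\tau_x\omega)=\varphi(\omega)$ for $\mathbb P$-a.e. $\omega$, is almost surely equal to a constant. Let $\kappa>0$ and let $a:\mathbb R\times\Omega\to[0,1]$ be jointly measurable with $a(x+y,\omega)=a(x,\tau_y\omega)$ for all $x,y,\omega$, such that $a(\cdot,\omega)>0$ on $\mathbb R$ for $\mathbb P$-a.e. $\omega$ and $\sqrt{a(\cdot,\omega)}$ is $\kappa$-Lipschitz on $\mathbb R$ for every $\omega$. Let $\alpha_0,\alpha_1>0$, $\gamma>2$, and let $H:\mathbb R\times\mathbb R\times\Omega\to\mathbb R$ be jointly measurable with $H(x+y,p,\omega)=H(x,p,\tau_y\omega)$ and, for all $x,y,p,q\in\mathbb R$ and $\omega\in\Omega$, $$\alpha_0|p|^\gamma-\tfrac1{\alpha_0}\le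 H(x,p,\omega)\le\alpha_1(|p|^\gamma+1),$$ $$|H(x,p,\omega)-H(x,q,\omega)|\le\alpha_1(|p|+|q|+1)^{\gamma-1}|p-q|,$$ $$|H(x,p,\omega)-H(y,p,\omega)|\le\alpha_1(|p|^\gamma+1)|x-y|.$$ For $\omega\in\Omega$ let $\Lambda(\omega)$ be the set of $\lambda\in\mathbb R$ for which the equation $a(x,\omega)u''+H(x,u',\omega)=\lambda$ in $\mathbb R$ admits a continuous viscosity supersolution, i.e. a continuous $u:\mathbb R\to\mathbb R$ such that $a(x_0,\omega)\varphi''(x_0)+H(x_0,\varphi'(x_0),\omega)\le\lambda$ whenever $\varphi\in C^2(\mathbb R)$ and $u-\varphi$ has a local minimum at $x_0$. Put $\lambda_0(\omega):=\inf\Lambda(\omega)$. Then $\Lambda(\omega)$ is nonempty and bounded below for every $\omega$, so that $\lambda_0:\Omega\to\mathbb R$ is well defined; $\lambda_0$ is measurable; it is stationary, i.e. $\lambda_0(\tau_y\omega)=\lambda_0(\omega)$ for all $y\in\mathbb R$ and $\omega\in\Omega$; and there is a constant $c\in\mathbb R$ with $\lambda_0(\omega)=c$ for $\mathbb P$-a.e.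 $\omega$. -/

import Mathlib

open MeasureTheory

namespace ViscousHJ

/-- A measure-preserving ergodic action of the group `(ℝ, +)` on a probability space. Ergodicity:
a measurable function which, for each fixed `x`, is almost surely invariant under `τ x` is almost
surely constant. (Joint measurability of `(x, ω) ↦ τ x ω` is not demanded.) -/
structure IsErgodicAction {Ω : Type*} [MeasurableSpace Ω] (P : Measure Ω) (τ : ℝ → Ω → Ω) :
    Prop where
  zero : ∀ ω, τ 0 ω = ω
  add : ∀ x y ω, τ (x + y) ω = τ x (τ y ω)
  measurePreserving : ∀ x, MeasurePreserving (τ x) P P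
  ergodic : ∀ φ : Ω → ℝ, Measurable φ → (∀ x, ∀ᵐ ω ∂P, φ (τ x ω) = φ ω) →
    ∃ c : ℝ, ∀ᵐ ω ∂P, φ ω = c

/-- Stationary diffusion coefficients `a : ℝ × Ω → [0, 1]`, almost surely positive everywhere,
whose square root is `κ`-Lipschitz in `x` for every `ω`. -/
structure IsDiffusionCoefficient {Ω : Type*} [MeasurableSpace Ω] (P : Measure Ω)
    (τ : ℝ → Ω → Ω) (κ : ℝ) (a : ℝ → Ω → ℝ) : Prop where
  measurable : Measurable fun z : ℝ × Ω => a z.1 z.2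
  stationary : ∀ x y ω, a (x + y) ω = a x (τ y ω)
  mem_Icc : ∀ x ω, a x ω ∈ Set.Icc (0 : ℝ) 1
  pos : ∀ᵐ ω ∂P, ∀ x, 0 < a x ω
  sqrt_lipschitz : ∀ ω x y, |√(a x ω) - √(a y ω)| ≤ κ * |x - y|

/-- The growth and regularity class of Hamiltonians `H x p ω` with parameters `α₀`, `α₁`, `γ`. -/
structure InHamiltonianClass {Ω : Type*} (α₀ α₁ γ : ℝ) (H : ℝ → ℝ → Ω → ℝ) : Prop where
  lower : ∀ x p ω, α₀ * |p| ^ γ - 1 / α₀ ≤ H x p ω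
  upper : ∀ x p ω, H x p ω ≤ α₁ * (|p| ^ γ + 1)
  lipschitz_momentum : ∀ x p q ω,
    |H x p ω - H x q ω| ≤ α₁ * (|p| + |q| + 1) ^ (γ - 1) * |p - q|
  lipschitz_space : ∀ x y p ω, |H x p ω - H y p ω| ≤ α₁ * (|p| ^ γ + 1) * |x - y|

/-- Measurable Hamiltonians that are stationary with respect to shifts in `x`. -/
structure IsStationaryHamiltonian {Ω : Type*} [MeasurableSpace Ω] (τ : ℝ → Ω → Ω)
    (H : ℝ → ℝ → Ω → ℝ) : Prop where
  measurable : Measurable fun z : ℝ × ℝ × Ω => H z.1 z.2.1 z.2.2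
  stationary : ∀ x y p ω, H (x + y) p ω = H x p (τ y ω)

/-- `u` is a continuous viscosity supersolution of the deterministic equation
`b(x) u'' + G(x, u') = l` in `ℝ`: whenever a `C²` function `φ` touches `u` from below at `x₀`
(up to an additive constant, locally), one has `b(x₀) φ''(x₀) + G(x₀, φ'(x₀)) ≤ l`. -/
def IsViscositySupersolution (b : ℝ → ℝ) (G : ℝ → ℝ → ℝ) (l : ℝ) (u : ℝ → ℝ) : Prop :=
  Continuous u ∧ ∀ (φ : ℝ → ℝ) (x₀ : ℝ), ContDiff ℝ 2 φ → IsLocalMin (fun x => u x - φ x) x₀ →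
    b x₀ * deriv (deriv φ) x₀ + G x₀ (deriv φ x₀) ≤ l

/-- The levels `l` for which `b(x) u'' + G(x, u') = l` has a continuous viscosity supersolution. -/
def supersolutionLevels (b : ℝ → ℝ) (G : ℝ → ℝ → ℝ) : Set ℝ :=
  {l : ℝ | ∃ u : ℝ → ℝ, IsViscositySupersolution b G l u}

/-- The critical value `λ₀(ω)`: the infimum of the levels admitting a supersolution. -/
noncomputable def criticalValue {Ω : Type*} (a : ℝ → Ω → ℝ) (H : ℝ → ℝ → Ω → ℝ) (ω : Ω) : ℝ :=
  sInf (supersolutionLevels (fun x => a x ω) (fun x p => H x p ω))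

end ViscousHJ

/-! The constant function is a supersolution at level `α₁`, so levels exist. Conversely, if `u` is a
supersolution, then `v = -u` satisfies `α₀|v'|^γ - v'' ≤ l + 1/α₀` in a weak sense, because `0 ≤ a ≤
1`. A slope that is too large then grows superlinearly and blows up within a finite distance, so `u`
is Lipschitz with a constant depending only on `l`, `α₀`, `γ` (`abs_sub_le`). Comparison with a
steep parabola then bounds the levels below (`neg_six_le`).

The uniform Lipschitz bound also gives measurability. Normalized supersolutions range over a compact
set and the supersolution property is closed jointly in coefficients and function, so the
coefficients admitting level `l` form a closed set. Its preimage under the measurable map from `ω`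
to the coefficients is measurable, with no measurable selection. Translating supersolutions gives
stationarity, and ergodicity concludes. -/

namespace ViscousHJ

open Set Filter Topology

/-! ### One-dimensional gradient bounds by blow-up of slopes -/

/-- If `f` has no interior local maximum on `(y, z)` and `f y < f x`, then `f x ≤ f z`. -/
lemma le_of_forall_not_isLocalMax {f : ℝ → ℝ} {x y z : ℝ} (hf : Continuous f) (hyx : y < x)
    (hxz : x ≤ z) (h : ∀ t ∈ Ioo y z, ¬ IsLocalMax f t) (hlt : f y < f x) : f x ≤ f z := by
  by_contra! hz
  obtain ⟨t, ht, hmax⟩ := isCompact_Icc.exists_isMaxOn (nonempty_Icc.2 (hyx.le.trans hxz))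
    hf.continuousOn
  have hxt : f x ≤ f t := hmax ⟨hyx.le, hxz⟩
  have hty : y ≠ t := by rintro rfl; linarith
  have htz : t ≠ z := by rintro rfl; linarith
  have hlo := lt_of_le_of_ne ht.1 hty
  have hhi := lt_of_le_of_ne ht.2 htz
  exact h t ⟨hlo, hhi⟩ (hmax.isLocalMax (Icc_mem_nhds hlo hhi))

/-- Continuous functions satisfying `α |v'| ^ γ - v'' ≤ C` when tested from above with convex
quadratic polynomials. -/
def IsQuadraticSubsolution (α γ C : ℝ) (v : ℝ → ℝ) : Prop :=
  Continuous v ∧ ∀ c p x₀ : ℝ, 0 ≤ c → IsLocalMax (fun x => v x - (c * x ^ 2 + p * x)) x₀ →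
    α * |2 * c * x₀ + p| ^ γ ≤ C + 2 * c

/-- The increments of `v` over subintervals of `[s, ∞)` have slope at least `P`. -/
def HasSlopeGE (v : ℝ → ℝ) (P s : ℝ) : Prop :=
  ∀ x y, s ≤ x → x ≤ y → P * (y - x) ≤ v y - v x

namespace IsQuadraticSubsolution

variable {α γ C : ℝ} {v : ℝ → ℝ}

lemma comp_neg (hv : IsQuadraticSubsolution α γ C v) :
    IsQuadraticSubsolution α γ C fun x => v (-x) := by
  refine ⟨hv.1.comp continuous_neg, fun c p x₀ hc hmax => ?_⟩
  have h1 : IsLocalMax (fun x => v (-x) - (c * x ^ 2 + p * x)) (- -x₀) := by rwa [neg_neg]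
  have h2 := h1.comp_continuous (g := fun x : ℝ => -x) continuous_neg.continuousAt
  have h3 := hv.2 c (-p) (-x₀) hc (by
    convert h2 using 2 with x
    simp [Function.comp])
  rwa [show 2 * c * -x₀ + -p = -(2 * c * x₀ + p) by ring, abs_neg] at h3

/-- As `C < α P ^ γ`, the function `v t - P t` has no local maximum: once it has risen, it can never
come down again. -/
lemma hasSlopeGE_of_lt (hv : IsQuadraticSubsolution α γ C v) {P x y : ℝ} (hP : 0 ≤ P)
    (hC : C < α * P ^ γ) (hyx : y < x) (h : P * (x - y) < v x - v y) : HasSlopeGE v P x := by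
  set f : ℝ → ℝ := fun t => v t - (0 * t ^ 2 + P * t) with hf
  have hfc : Continuous f := hv.1.sub (by fun_prop)
  have hno : ∀ t, ¬ IsLocalMax f t := fun t ht => by
    have := hv.2 0 P t le_rfl ht
    simp only [mul_zero, zero_mul, zero_add, add_zero, abs_of_nonneg hP] at this
    linarith
  have hlt : f y < f x := by simp only [hf]; linarith
  intro s t hs hst
  have h1 : f x ≤ f s := le_of_forall_not_isLocalMax hfc hyx hs (fun t _ => hno t) hlt
  have h2 : f s ≤ f t :=
    le_of_forall_not_isLocalMax hfc (hyx.trans_le hs) hst (fun t _ => hno t) (hlt.trans_le h1)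
  simp only [hf] at h2
  linarith

/-- Comparison with a parabola whose slope runs from `P / 2` at `s` to `2 P` at `s + d`. With `d` of
order `1 / P`, its second derivative `2 c` is of order `P ^ 2`, which `α (P / 2) ^ γ / 2` absorbs
because `2 ≤ γ`. -/
lemma hasSlopeGE_step (hv : IsQuadraticSubsolution α γ C v) (hα : 0 < α) (hγ : 2 ≤ γ)
    {P s : ℝ} (hP : 1 ≤ P) (hC : C < α * (P / 2) ^ γ / 2) (h : HasSlopeGE v P s) :
    HasSlopeGE v (3 / 2 * P) (s + 3 * 2 ^ γ / α / P) := by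
  have hP0 : 0 < P := by linarith
  have h2γ : (0 : ℝ) < 2 ^ γ := by positivity
  set d := 3 * 2 ^ γ / α / P with hd
  have hd0 : 0 < d := by positivity
  set c := 3 * P / (4 * d) with hc
  have hc0 : 0 < c := by positivity
  have hcd : c * d = 3 * P / 4 := by rw [hc]; field_simp
  have h2c : 2 * c ≤ α * (P / 2) ^ γ / 2 := by
    have hsq : P ^ 2 ≤ P ^ γ := by
      have := Real.rpow_le_rpow_of_exponent_le hP hγ
      rwa [Real.rpow_two] at this
    have : 2 * c = α / (2 * 2 ^ γ) * P ^ 2 := by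
      rw [hc, hd]; field_simp; ring
    rw [this, Real.div_rpow hP0.le zero_le_two]
    calc α / (2 * 2 ^ γ) * P ^ 2 ≤ α / (2 * 2 ^ γ) * P ^ γ := by gcongr
      _ = _ := by field_simp
  set f : ℝ → ℝ := fun t => v t - (c * t ^ 2 + (P / 2 - 2 * c * s) * t) with hf
  have hfc : Continuous f := hv.1.sub (by fun_prop)
  have hno : ∀ t ∈ Ioo s (s + d), ¬ IsLocalMax f t := fun t ht hmax => by
    have h1 := hv.2 c _ t hc0.le hmax
    have h2 : P / 2 ≤ 2 * c * t + (P / 2 - 2 * c * s) := by nlinarith [ht.1]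
    have h3 : (P / 2) ^ γ ≤ |2 * c * t + (P / 2 - 2 * c * s)| ^ γ :=
      Real.rpow_le_rpow (by positivity) (h2.trans (le_abs_self _)) (by linarith)
    have h4 := mul_le_mul_of_nonneg_left h3 hα.le
    linarith
  -- On the first third the parabola rises by `P d / 4`, less than the `P d / 3` gained by `v`. On
  -- the last third it rises by `7 P d / 12`, more than the `P d / 2` that slope `3 P / 2` requires.
  have hlt : f s < f (s + d / 3) := by
    have h1 := h s (s + d / 3) le_rfl (by linarith)
    have h2 : c * (s + d / 3) ^ 2 + (P / 2 - 2 * c * s) * (s + d / 3) -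
        (c * s ^ 2 + (P / 2 - 2 * c * s) * s) = P / 2 * (d / 3) + 1 / 9 * (c * d) * d := by ring
    rw [hcd] at h2
    have h4 := mul_pos hP0 hd0
    simp only [hf]
    nlinarith
  have h1 : f (s + d / 3) ≤ f (s + 2 * d / 3) :=
    le_of_forall_not_isLocalMax hfc (by linarith) (by linarith)
      (fun t ht => hno t ⟨ht.1, by linarith [ht.2]⟩) hlt
  have h2 : f (s + 2 * d / 3) ≤ f (s + d) :=
    le_of_forall_not_isLocalMax hfc (by linarith) (by linarith) hno (hlt.trans_le h1)
  refine hv.hasSlopeGE_of_lt (y := s + 2 * d / 3) (by positivity) ?_ (by linarith) ?_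
  · have h3 : (P / 2) ^ γ ≤ (3 / 2 * P) ^ γ :=
      Real.rpow_le_rpow (by positivity) (by linarith) (by linarith)
    have h4 := mul_le_mul_of_nonneg_left h3 hα.le
    have h5 : 0 < α * (P / 2) ^ γ := by positivity
    linarith
  · simp only [hf] at h2
    have h3 : c * (s + d) ^ 2 + (P / 2 - 2 * c * s) * (s + d) -
        (c * (s + 2 * d / 3) ^ 2 + (P / 2 - 2 * c * s) * (s + 2 * d / 3)) =
        P / 2 * (d / 3) + 5 / 9 * (c * d) * d := by ring
    rw [hcd] at h3
    have h4 := mul_pos hP0 hd0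
    nlinarith

/-- Iterating the step multiplies the slope by `3 / 2` at the cost of a length `A / slope`. These
lengths sum to `3 A / P`, so beyond `s + 3 A / P` every slope bound would hold. -/
lemma not_hasSlopeGE (hv : IsQuadraticSubsolution α γ C v) (hα : 0 < α) (hγ : 2 ≤ γ)
    {P s : ℝ} (hP : 1 ≤ P) (hC : C < α * (P / 2) ^ γ / 2) : ¬ HasSlopeGE v P s := by
  intro h
  have hP0 : 0 < P := by linarith
  set A := 3 * 2 ^ γ / α with hA
  have hA0 : 0 < A := by positivity
  have key : ∀ k : ℕ, HasSlopeGE v ((3 / 2) ^ k * P)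
      (s + 3 * A / P - 3 * A / ((3 / 2) ^ k * P)) := by
    intro k
    induction k with
    | zero => simpa using h
    | succ k ih =>
      have h1 : P ≤ (3 / 2) ^ k * P :=
        le_mul_of_one_le_left hP0.le (one_le_pow₀ (by norm_num))
      have h2 : (P / 2) ^ γ ≤ ((3 / 2) ^ k * P / 2) ^ γ :=
        Real.rpow_le_rpow (by positivity) (by linarith) (by linarith)
      have h3 := mul_le_mul_of_nonneg_left h2 hα.le
      have h4 := hv.hasSlopeGE_step hα hγ (hP.trans h1) (by linarith) ih
      rw [← hA] at h4
      convert h4 using 1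
      · ring
      · have : (0 : ℝ) < (3 / 2) ^ k := by positivity
        rw [pow_succ]
        field_simp
        ring
  obtain ⟨k, hk⟩ := pow_unbounded_of_one_lt (v (s + 3 * A / P + 1) - v (s + 3 * A / P))
    (show (1 : ℝ) < 3 / 2 by norm_num)
  have h1 := key k (s + 3 * A / P) (s + 3 * A / P + 1)
    (by simp only [sub_le_self_iff]; positivity) (by linarith)
  have h2 : (3 / 2 : ℝ) ^ k ≤ (3 / 2) ^ k * P := le_mul_of_one_le_right (by positivity) hP
  linarith

lemma abs_sub_le (hv : IsQuadraticSubsolution α γ C v) (hα : 0 < α) (hγ : 2 ≤ γ)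
    {P : ℝ} (hP : 1 ≤ P) (hC : C < α * (P / 2) ^ γ / 2) (x y : ℝ) :
    |v x - v y| ≤ P * |x - y| := by
  have hP0 : 0 < P := by linarith
  have hCP : C < α * P ^ γ := by
    have h3 : (P / 2) ^ γ ≤ P ^ γ :=
      Real.rpow_le_rpow (by positivity) (by linarith) (by linarith)
    have h4 := mul_le_mul_of_nonneg_left h3 hα.le
    have h5 : 0 < α * (P / 2) ^ γ := by positivity
    linarith
  have key : ∀ w, IsQuadraticSubsolution α γ C w → ∀ x y, y < x → w x - w y ≤ P * (x - y) := by
    intro w hw x y hyx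
    by_contra! hlt
    exact hw.not_hasSlopeGE hα hγ hP hC (hw.hasSlopeGE_of_lt hP0.le hCP hyx hlt)
  have key2 : ∀ x y, y < x → |v x - v y| ≤ P * |x - y| := by
    intro x y hyx
    rw [abs_of_pos (sub_pos.2 hyx), abs_le]
    have h1 := key v hv x y hyx
    have h2 := key _ hv.comp_neg (-y) (-x) (by linarith)
    simp only [neg_neg] at h2
    constructor <;> linarith
  rcases lt_trichotomy x y with h | h | h
  · rw [abs_sub_comm, abs_sub_comm x]; exact key2 y x h
  · simp [h]
  · exact key2 x y h

lemma neg_six_le (hv : IsQuadraticSubsolution α γ C v) (hα : 0 < α) (hγ : 2 ≤ γ) : -6 ≤ C := by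
  by_contra! hC
  -- A negative `C` allows `P = 2`. The parabola `3 t ^ 2` then forces an increment of at least `3`
  -- on `[0, 1]`.
  have hL := hv.abs_sub_le hα hγ one_le_two (by simp; linarith)
  set f : ℝ → ℝ := fun t => v t - (3 * t ^ 2 + 0 * t) with hf
  have hfc : Continuous f := hv.1.sub (by fun_prop)
  have hno : ∀ t, ¬ IsLocalMax f t := fun t ht => by
    have h1 := hv.2 3 0 t (by norm_num) ht
    have : 0 ≤ α * |2 * 3 * t + 0| ^ γ := by positivity
    linarith
  have h1 := abs_le.1 (hL 0 (-1))
  have h2 := abs_le.1 (hL 1 0)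
  norm_num at h1 h2
  have h3 : f 0 ≤ f 1 := le_of_forall_not_isLocalMax hfc (y := -1) (by norm_num) (by norm_num)
    (fun t _ => hno t) (by simp only [hf]; linarith)
  simp only [hf] at h3
  linarith

end IsQuadraticSubsolution

lemma exists_lt_mul_rpow {α γ : ℝ} (hα : 0 < α) (hγ : 1 ≤ γ) (C : ℝ) :
    ∃ P : ℝ, 1 ≤ P ∧ C < α * (P / 2) ^ γ / 2 := by
  refine ⟨2 * (2 * |C| / α + 1), ?_, ?_⟩
  · have : 0 ≤ |C| / α := by positivity
    linarith [show 2 * |C| / α = 2 * (|C| / α) by ring]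
  · rw [mul_div_cancel_left₀ _ two_ne_zero]
    have h1 : (1 : ℝ) ≤ 2 * |C| / α + 1 := by
      have : 0 ≤ 2 * |C| / α := by positivity
      linarith
    have h2 := Real.rpow_le_rpow_of_exponent_le h1 hγ
    rw [Real.rpow_one] at h2
    have h3 := mul_le_mul_of_nonneg_left h2 hα.le
    have h4 : α * (2 * |C| / α + 1) = 2 * |C| + α := by field_simp
    linarith [le_abs_self C]

/-- For convex tests the second-order term has a known sign, so the bound `b ≤ 1` alone removes `b`
from the inequality. -/
lemma IsViscositySupersolution.neg_isQuadraticSubsolution {b : ℝ → ℝ} {G : ℝ → ℝ → ℝ}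
    {l α γ : ℝ} {u : ℝ → ℝ} (hu : IsViscositySupersolution b G l u)
    (hb : ∀ x, b x ∈ Icc (0 : ℝ) 1) (hG : ∀ x p, α * |p| ^ γ - 1 / α ≤ G x p) :
    IsQuadraticSubsolution α γ (l + 1 / α) fun x => -u x := by
  refine ⟨hu.1.neg, fun c p x₀ hc hmax => ?_⟩
  have hd : deriv (fun x : ℝ => -(c * x ^ 2 + p * x)) = fun x => -(2 * c * x + p) := by
    funext x
    have : HasDerivAt (fun x : ℝ => -(c * x ^ 2 + p * x)) (-(c * (2 * x) + p * 1)) x := by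
      simpa using! (((hasDerivAt_pow 2 x).const_mul c).add ((hasDerivAt_id x).const_mul p)).neg
    rw [this.deriv]; ring
  have hdd : deriv (fun x : ℝ => -(2 * c * x + p)) x₀ = -(2 * c) := by
    have : HasDerivAt (fun x : ℝ => -(2 * c * x + p)) (-(2 * c * 1)) x₀ :=
      (((hasDerivAt_id x₀).const_mul (2 * c)).add_const p).neg
    rw [this.deriv]; ring
  have h := hu.2 (fun x => -(c * x ^ 2 + p * x)) x₀ (by fun_prop) (by
    refine hmax.neg.congr (Eventually.of_forall fun x => ?_)
    show -(-u x - (c * x ^ 2 + p * x)) = u x - -(c * x ^ 2 + p * x)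
    ring)
  rw [hd, hdd] at h
  have h1 := hG x₀ (-(2 * c * x₀ + p))
  rw [abs_neg] at h1
  have h2 : b x₀ * (2 * c) ≤ 1 * (2 * c) :=
    mul_le_mul_of_nonneg_right (hb x₀).2 (by positivity)
  simp only [] at h h1
  linarith

/-! ### Measurability of random continuous coefficients -/

/-- A map into a space of continuous functions is Borel measurable for the compact-open topology
as soon as its evaluations are measurable. -/
lemma measurable_borel_continuousMap {Ω X Y : Type*} [MeasurableSpace Ω] [TopologicalSpace X]
    [SecondCountableTopology X] [LocallyCompactSpace X] [PseudoMetricSpace Y]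
    [SecondCountableTopology Y] [MeasurableSpace Y] [BorelSpace Y] (F : Ω → C(X, Y))
    (hF : ∀ x, Measurable fun ω => F ω x) : @Measurable Ω C(X, Y) _ (borel C(X, Y)) F := by
  rw [borel_eq_generateFrom_of_subbasis ContinuousMap.compactOpen_eq]
  refine measurable_generateFrom ?_
  rintro _ ⟨K, hK, U, hU, rfl⟩
  obtain ⟨D, hDK, hDc, hKD⟩ : ∃ D ⊆ K, D.Countable ∧ K ⊆ closure D := by
    obtain ⟨D, hDc, hD⟩ := TopologicalSpace.exists_countable_dense K
    refine ⟨(↑) '' D, by simp, hDc.image _, fun x hx => ?_⟩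
    exact image_closure_subset_closure_image continuous_subtype_val ⟨⟨x, hx⟩, hD _, rfl⟩
  -- The compact image of `K` stays a positive distance from `Uᶜ`, and such a closed condition can
  -- be checked on a countable dense subset.
  have hset : F ⁻¹' {f | MapsTo f K U} =
      ⋃ n : ℕ, ⋂ x ∈ D, {ω | ((n : ENNReal) + 1)⁻¹ ≤ Metric.infEDist (F ω x) Uᶜ} := by
    ext ω
    simp only [mem_preimage, mem_ofPred_eq, mem_iUnion, mem_iInter]
    constructor
    · intro h
      obtain ⟨δ, hδ, hsub⟩ := (hK.image (F ω).continuous).exists_thickening_subset_open hU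
        h.image_subset
      obtain ⟨n, hn⟩ := ENNReal.exists_inv_nat_lt (ENNReal.ofReal_pos.2 hδ).ne'
      refine ⟨n, fun x hx => ?_⟩
      refine (ENNReal.inv_le_inv.2 le_self_add).trans (hn.le.trans ?_)
      refine Metric.le_infEDist.2 fun y hy => ?_
      by_contra! hlt
      refine hy (hsub ?_)
      rw [Metric.mem_thickening_iff_infEDist_lt]
      refine (Metric.infEDist_le_edist_of_mem (mem_image_of_mem _ (hDK hx))).trans_lt ?_
      rwa [edist_comm]
    · rintro ⟨n, hn⟩ x hx
      have hcl : IsClosed {x | ((n : ENNReal) + 1)⁻¹ ≤ Metric.infEDist (F ω x) Uᶜ} :=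
        isClosed_le continuous_const (Metric.continuous_infEDist.comp (F ω).continuous)
      have hxm : ((n : ENNReal) + 1)⁻¹ ≤ Metric.infEDist (F ω x) Uᶜ :=
        closure_minimal (show D ⊆ _ from hn) hcl (hKD hx)
      by_contra hxU
      rw [Metric.infEDist_zero_of_mem (show F ω x ∈ Uᶜ from hxU)] at hxm
      simp at hxm
  rw [hset]
  refine MeasurableSet.iUnion fun n => MeasurableSet.biInter hDc fun x _ => ?_
  exact measurableSet_le measurable_const (measurable_infEDist.comp (hF x))

/-! ### Compactness and stability of supersolutions -/

/-- Viscosity supersolutions of `b(x) u'' + G(x, u') = l`, with coefficients bundled into the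
continuous map `(x, p) ↦ (b(x), G(x, p))`; continuity of `u` is not included. -/
def IsSupersolutionFor (F : C(ℝ × ℝ, ℝ × ℝ)) (l : ℝ) (u : ℝ → ℝ) : Prop :=
  ∀ (φ : ℝ → ℝ) (x₀ : ℝ), ContDiff ℝ 2 φ → IsLocalMin (fun x => u x - φ x) x₀ →
    (F (x₀, deriv φ x₀)).1 * deriv (deriv φ) x₀ + (F (x₀, deriv φ x₀)).2 ≤ l

/-- Normalized `P`-Lipschitz functions on the line. -/
def lipschitzFunctions (P : ℝ) : Set (ℝ → ℝ) :=
  {u | u 0 = 0 ∧ ∀ x y, |u x - u y| ≤ P * |x - y|}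

lemma continuous_of_mem_lipschitzFunctions {P : ℝ} {u : ℝ → ℝ} (hu : u ∈ lipschitzFunctions P) :
    Continuous u := by
  refine (LipschitzWith.of_dist_le_mul (K := P.toNNReal) fun x y => ?_).continuous
  rw [Real.dist_eq, Real.dist_eq]
  exact (hu.2 x y).trans (by gcongr; exact Real.le_coe_toNNReal P)

/-- Tychonoff, in the topology of pointwise convergence. -/
lemma isCompact_lipschitzFunctions (P : ℝ) : IsCompact (lipschitzFunctions P) := by
  refine (isCompact_univ_pi fun x : ℝ =>
    isCompact_Icc (a := -(P * |x|)) (b := P * |x|)).of_isClosed_subset ?_ ?_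
  · rw [lipschitzFunctions, ofPred_and]
    refine (isClosed_eq (continuous_apply 0) continuous_const).inter ?_
    simp only [ofPred_forall]
    exact isClosed_iInter fun x => isClosed_iInter fun y =>
      isClosed_le (by fun_prop) continuous_const
  · intro u hu x _
    have := hu.2 x 0
    rw [hu.1, sub_zero, sub_zero] at this
    exact abs_le.1 this

lemma isClosed_isSupersolutionFor (P l : ℝ) :
    IsClosed {z : C(ℝ × ℝ, ℝ × ℝ) × lipschitzFunctions P | IsSupersolutionFor z.1 l z.2} := by
  rw [← isOpen_compl_iff, isOpen_iff_mem_nhds]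
  rintro ⟨F, u⟩ hFu
  simp only [mem_compl_iff, mem_ofPred_eq, IsSupersolutionFor, not_forall, not_le] at hFu
  obtain ⟨φ, x₀, hφ, hmin, hlt⟩ := hFu
  -- The quartic makes the minimum strict without changing the first two derivatives at `x₀`. In
  -- dimension one, comparing values at `x₀` and `x₀ ± r` then traps a nearby minimum, so pointwise
  -- convergence suffices.
  set ψ : ℝ → ℝ := fun x => φ x - (x - x₀) ^ 4 with hψ
  have hψC : ContDiff ℝ 2 ψ := hφ.sub (by fun_prop)
  have hφd : Differentiable ℝ φ := hφ.differentiable two_ne_zero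
  have hφ1 : ContDiff ℝ 1 (deriv φ) := by
    have := (contDiff_succ_iff_deriv (n := 1)).1 hφ
    exact this.2.2
  have hψd : deriv ψ = fun x => deriv φ x - 4 * (x - x₀) ^ 3 := by
    funext x
    have := ((hφd x).hasDerivAt.sub (((hasDerivAt_id x).sub_const x₀).pow 4)).deriv
    simpa using! this
  have hψdd : deriv (deriv ψ) = fun x => deriv (deriv φ) x - 12 * (x - x₀) ^ 2 := by
    funext x
    rw [hψd]
    have := (((hφ1.differentiable one_ne_zero) x).hasDerivAt.sub
      ((((hasDerivAt_id x).sub_const x₀).pow 3).const_mul 4)).deriv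
    refine Eq.trans (by simpa using! this) ?_
    simp
    ring
  have hψ1 : Continuous (deriv ψ) := by
    rw [hψd]; exact hφ1.continuous.sub (by fun_prop)
  have hψ2 : Continuous (deriv (deriv ψ)) := by
    rw [hψdd]; exact (hφ1.continuous_deriv le_rfl).sub (by fun_prop)
  have hev : Continuous fun z : C(ℝ × ℝ, ℝ × ℝ) × ℝ => z.1 (z.2, deriv ψ z.2) := by
    fun_prop
  have hE : Continuous fun z : C(ℝ × ℝ, ℝ × ℝ) × ℝ =>
      (z.1 (z.2, deriv ψ z.2)).1 * deriv (deriv ψ) z.2 + (z.1 (z.2, deriv ψ z.2)).2 :=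
    (hev.fst.mul (hψ2.comp continuous_snd)).add hev.snd
  have hE0 : ∀ᶠ z in 𝓝 (F, x₀),
      l < (z.1 (z.2, deriv ψ z.2)).1 * deriv (deriv ψ) z.2 + (z.1 (z.2, deriv ψ z.2)).2 := by
    refine hE.continuousAt.eventually (lt_mem_nhds ?_)
    have e1 : deriv (deriv ψ) x₀ = deriv (deriv φ) x₀ := by rw [hψdd]; simp
    have e2 : deriv ψ x₀ = deriv φ x₀ := by rw [hψd]; simp
    show l < (F (x₀, deriv ψ x₀)).1 * deriv (deriv ψ) x₀ + (F (x₀, deriv ψ x₀)).2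
    rwa [e1, e2]
  rw [nhds_prod_eq, eventually_prod_iff] at hE0
  obtain ⟨pa, hpa, pb, hpb, hpab⟩ := hE0
  obtain ⟨r, hr, hball⟩ := Metric.nhds_basis_closedBall.eventually_iff.1 (hpb.and hmin)
  simp only [Metric.mem_closedBall, Real.dist_eq] at hball
  have hstrict : ∀ x, |x - x₀| = r → (u : ℝ → ℝ) x₀ - ψ x₀ < (u : ℝ → ℝ) x - ψ x := by
    intro x hx
    have h1 := (hball hx.le).2
    have h2 : 0 < (x - x₀) ^ 4 := by
      rw [← Even.pow_abs (by decide) (x - x₀), hx]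
      exact pow_pos hr 4
    simp only [hψ, sub_self]
    norm_num
    linarith
  have hnear : ∀ x, |x - x₀| = r → ∀ᶠ w : lipschitzFunctions P in 𝓝 u,
      (w : ℝ → ℝ) x₀ - ψ x₀ < (w : ℝ → ℝ) x - ψ x := by
    intro x hx
    have hcont : ∀ t, Continuous fun w : lipschitzFunctions P => (w : ℝ → ℝ) t - ψ t := fun t =>
      ((continuous_apply t).comp continuous_subtype_val).sub continuous_const
    exact (hcont x₀).continuousAt.eventually_lt (hcont x).continuousAt (hstrict x hx)
  have hl := hnear (x₀ - r) (by rw [sub_sub_cancel_left, abs_neg, abs_of_pos hr])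
  have hr' := hnear (x₀ + r) (by rw [add_sub_cancel_left, abs_of_pos hr])
  have := prod_mem_nhds hpa (hl.and hr')
  refine mem_of_superset this ?_
  rintro ⟨F', w⟩ ⟨hF', hwl, hwr⟩ hsuper
  have hwc : Continuous fun x => (w : ℝ → ℝ) x - ψ x :=
    (continuous_of_mem_lipschitzFunctions w.2).sub hψC.continuous
  obtain ⟨t, ht, hmin'⟩ := isCompact_Icc.exists_isMinOn
    (nonempty_Icc.2 (show x₀ - r ≤ x₀ + r by linarith)) hwc.continuousOn
  have hx0 : (w : ℝ → ℝ) t - ψ t ≤ (w : ℝ → ℝ) x₀ - ψ x₀ :=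
    hmin' ⟨by linarith, by linarith⟩
  have h1 : x₀ - r ≠ t := by rintro rfl; linarith
  have h2 : t ≠ x₀ + r := by rintro rfl; linarith
  have h3 := lt_of_le_of_ne ht.1 h1
  have h4 := lt_of_le_of_ne ht.2 h2
  have h5 := hsuper ψ t hψC (hmin'.isLocalMin (Icc_mem_nhds h3 h4))
  have h6 := hpab hF' (hball (x := t) (abs_le.2 ⟨by linarith, by linarith⟩)).1
  exact absurd h5 (not_le.2 h6)

/-- Projection along a compact factor is a closed map. -/
lemma isClosed_exists_isSupersolutionFor (P l : ℝ) :
    IsClosed {F : C(ℝ × ℝ, ℝ × ℝ) | ∃ u ∈ lipschitzFunctions P, IsSupersolutionFor F l u} := by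
  have : CompactSpace (lipschitzFunctions P) :=
    isCompact_iff_compactSpace.1 (isCompact_lipschitzFunctions P)
  convert isClosedMap_fst_of_compactSpace _ (isClosed_isSupersolutionFor P l) using 1
  ext F
  simp

/-! ### Supersolution levels of a deterministic equation -/

section Deterministic

variable {b : ℝ → ℝ} {G : ℝ → ℝ → ℝ} {l α γ : ℝ} {u : ℝ → ℝ}

lemma IsViscositySupersolution.mono {l' : ℝ} (hu : IsViscositySupersolution b G l u)
    (h : l ≤ l') : IsViscositySupersolution b G l' u :=
  ⟨hu.1, fun φ x₀ hφ hmin => (hu.2 φ x₀ hφ hmin).trans h⟩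

lemma IsViscositySupersolution.sub_const (hu : IsViscositySupersolution b G l u) (k : ℝ) :
    IsViscositySupersolution b G l fun x => u x - k := by
  refine ⟨hu.1.sub continuous_const, fun φ x₀ hφ hmin => hu.2 φ x₀ hφ ?_⟩
  filter_upwards [hmin] with x hx
  linarith

lemma IsViscositySupersolution.comp_add_const (hu : IsViscositySupersolution b G l u) (y : ℝ) :
    IsViscositySupersolution (fun x => b (x + y)) (fun x p => G (x + y) p) l
      fun x => u (x + y) := by
  refine ⟨hu.1.comp (continuous_add_const y), fun φ x₀ hφ hmin => ?_⟩
  have h1 : IsLocalMin (fun x => u (x + y) - φ x) (x₀ + y - y) := by rwa [add_sub_cancel_right]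
  have h2 := h1.comp_continuous (g := fun x : ℝ => x - y) (by fun_prop)
  have h3 := hu.2 (fun x => φ (x - y)) (x₀ + y) (by fun_prop) (by
    refine h2.congr (Eventually.of_forall fun x => ?_)
    simp [Function.comp])
  have hd : (deriv fun x => φ (x - y)) = fun x => deriv φ (x - y) :=
    funext fun x => deriv_comp_sub_const φ y x
  rw [hd, deriv_comp_sub_const (deriv φ), add_sub_cancel_right] at h3
  simpa only [add_sub_cancel_right] using h3

lemma isViscositySupersolution_zero (hb : ∀ x, 0 ≤ b x) (hG : ∀ x, G x 0 ≤ l) :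
    IsViscositySupersolution b G l fun _ => 0 := by
  refine ⟨continuous_const, fun φ x₀ hφ hmin => ?_⟩
  have hmax : IsLocalMax φ x₀ := by
    filter_upwards [hmin] with x hx
    linarith
  have h2 : deriv (deriv φ) x₀ ≤ 0 := by
    -- A positive second derivative would make `x₀` also a local minimum, so `φ` would be locally
    -- constant.
    by_contra! hpos
    have hmin' : IsLocalMin φ x₀ :=
      isLocalMin_of_deriv_deriv_pos hpos hmax.deriv_eq_zero hφ.continuous.continuousAt
    have hconst : φ =ᶠ[𝓝 x₀] fun _ => φ x₀ := by
      filter_upwards [hmax, hmin'] with x h1 h2 using le_antisymm h1 h2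
    have := hconst.deriv.deriv_eq
    simp at this
    linarith
  rw [hmax.deriv_eq_zero]
  have := mul_nonpos_of_nonneg_of_nonpos (hb x₀) h2
  linarith [hG x₀]

lemma bddBelow_supersolutionLevels (hα : 0 < α) (hγ : 2 ≤ γ) (hb : ∀ x, b x ∈ Icc (0 : ℝ) 1)
    (hG : ∀ x p, α * |p| ^ γ - 1 / α ≤ G x p) : BddBelow (supersolutionLevels b G) := by
  refine ⟨-6 - 1 / α, ?_⟩
  rintro l ⟨u, hu⟩
  linarith [(hu.neg_isQuadraticSubsolution hb hG).neg_six_le hα hγ]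

/-- Supersolutions can be sought among normalized Lipschitz functions. -/
lemma mem_supersolutionLevels_iff {P : ℝ} (hα : 0 < α) (hγ : 2 ≤ γ)
    (hb : ∀ x, b x ∈ Icc (0 : ℝ) 1) (hG : ∀ x p, α * |p| ^ γ - 1 / α ≤ G x p) (hP : 1 ≤ P)
    (hlP : l + 1 / α < α * (P / 2) ^ γ / 2) (F : C(ℝ × ℝ, ℝ × ℝ))
    (hF : ∀ x p, F (x, p) = (b x, G x p)) :
    l ∈ supersolutionLevels b G ↔ ∃ u ∈ lipschitzFunctions P, IsSupersolutionFor F l u := by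
  constructor
  · rintro ⟨u, hu⟩
    refine ⟨fun x => u x - u 0, ⟨sub_self _, fun x y => ?_⟩, fun φ x₀ hφ hmin => ?_⟩
    · have := (hu.neg_isQuadraticSubsolution hb hG).abs_sub_le hα hγ hP hlP y x
      rw [abs_sub_comm x y]
      convert this using 2
      ring
    · rw [hF]
      exact (hu.sub_const (u 0)).2 φ x₀ hφ hmin
  · rintro ⟨u, hu, hs⟩
    refine ⟨u, continuous_of_mem_lipschitzFunctions hu, fun φ x₀ hφ hmin => ?_⟩
    simpa only [hF] using hs φ x₀ hφ hmin

end Deterministic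

/-! ### Measurability and stationarity of the levels -/

section Stochastic

variable {Ω : Type*} {α₀ α₁ γ κ : ℝ} {a : ℝ → Ω → ℝ} {H : ℝ → ℝ → Ω → ℝ}

lemma InHamiltonianClass.continuous (hH : InHamiltonianClass α₀ α₁ γ H) (hγ : 1 ≤ γ) (ω : Ω) :
    Continuous fun z : ℝ × ℝ => H z.1 z.2 ω := by
  refine continuous_iff_continuousAt.2 fun ⟨x₀, p₀⟩ => ?_
  rw [ContinuousAt, tendsto_iff_dist_tendsto_zero]
  have hc : Continuous fun z : ℝ × ℝ => α₁ * (|z.2| ^ γ + 1) * |z.1 - x₀| +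
      α₁ * (|z.2| + |p₀| + 1) ^ (γ - 1) * |z.2 - p₀| := by
    refine (Continuous.mul (continuous_const.mul (Continuous.add ?_ continuous_const))
      (by fun_prop)).add (Continuous.mul (continuous_const.mul ?_) (by fun_prop))
    · exact Continuous.rpow_const (by fun_prop) fun _ => Or.inr (by linarith)
    · exact Continuous.rpow_const (by fun_prop) fun _ => Or.inr (by linarith)
  have h0 := hc.tendsto (x₀, p₀)
  simp only [sub_self, abs_zero, mul_zero, add_zero] at h0
  refine squeeze_zero (fun _ => dist_nonneg) (fun z => ?_) h0
  rw [Real.dist_eq]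
  exact (abs_sub_le _ (H x₀ z.2 ω) _).trans
    (add_le_add (hH.lipschitz_space _ _ _ _) (hH.lipschitz_momentum _ _ _ _))

variable [MeasurableSpace Ω] {P : Measure Ω} {τ : ℝ → Ω → Ω}

lemma IsDiffusionCoefficient.continuous (ha : IsDiffusionCoefficient P τ κ a) (ω : Ω) :
    Continuous fun x => a x ω := by
  have hs : Continuous fun x => √(a x ω) := by
    refine (LipschitzWith.of_dist_le_mul (K := κ.toNNReal) fun x y => ?_).continuous
    rw [Real.dist_eq, Real.dist_eq]
    exact (ha.sqrt_lipschitz ω x y).trans (by gcongr; exact Real.le_coe_toNNReal κ)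
  refine (hs.pow 2).congr fun x => Real.sq_sqrt (ha.mem_Icc x ω).1

lemma measurableSet_mem_supersolutionLevels (ha : IsDiffusionCoefficient P τ κ a)
    (hH : IsStationaryHamiltonian τ H) (hclass : InHamiltonianClass α₀ α₁ γ H)
    (hα₀ : 0 < α₀) (hγ : 2 ≤ γ) (l : ℝ) :
    MeasurableSet {ω | l ∈ supersolutionLevels (fun x => a x ω) fun x p => H x p ω} := by
  -- The Lipschitz constant `R` does not depend on `ω`, so one compact set serves all `ω`.
  obtain ⟨R, hR, hlR⟩ := exists_lt_mul_rpow hα₀ (one_le_two.trans hγ) (l + 1 / α₀)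
  let F : Ω → C(ℝ × ℝ, ℝ × ℝ) := fun ω => ⟨fun z => (a z.1 ω, H z.1 z.2 ω),
    ((ha.continuous ω).comp continuous_fst).prodMk
      (hclass.continuous (one_le_two.trans hγ) ω)⟩
  have hF : @Measurable Ω C(ℝ × ℝ, ℝ × ℝ) _ (borel _) F := by
    refine measurable_borel_continuousMap F fun z => Measurable.prodMk ?_ ?_
    · exact ha.measurable.comp (measurable_const.prodMk measurable_id)
    · exact hH.measurable.comp
        (measurable_const.prodMk (measurable_const.prodMk measurable_id))
  let _ : MeasurableSpace C(ℝ × ℝ, ℝ × ℝ) := borel _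
  have : BorelSpace C(ℝ × ℝ, ℝ × ℝ) := ⟨rfl⟩
  convert hF (isClosed_exists_isSupersolutionFor R l).measurableSet using 1
  ext ω
  exact mem_supersolutionLevels_iff hα₀ hγ (fun x => ha.mem_Icc x ω)
    (fun x p => hclass.lower x p ω) hR hlR (F ω) fun _ _ => rfl

lemma supersolutionLevels_shift_subset
    (ha : IsDiffusionCoefficient P τ κ a) (hH : IsStationaryHamiltonian τ H) (y : ℝ) (ω : Ω) :
    supersolutionLevels (fun x => a x ω) (fun x p => H x p ω) ⊆
      supersolutionLevels (fun x => a x (τ y ω)) fun x p => H x p (τ y ω) := by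
  rintro l ⟨u, hu⟩
  refine ⟨fun x => u (x + y), ?_⟩
  simpa only [ha.stationary, hH.stationary] using hu.comp_add_const y

lemma supersolutionLevels_shift (hτ : IsErgodicAction P τ)
    (ha : IsDiffusionCoefficient P τ κ a) (hH : IsStationaryHamiltonian τ H) (y : ℝ) (ω : Ω) :
    supersolutionLevels (fun x => a x (τ y ω)) (fun x p => H x p (τ y ω)) =
      supersolutionLevels (fun x => a x ω) fun x p => H x p ω := by
  refine (supersolutionLevels_shift_subset ha hH y ω).antisymm' ?_
  have := supersolutionLevels_shift_subset ha hH (-y) (τ y ω)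
  rwa [← hτ.add, neg_add_cancel, hτ.zero] at this

end Stochastic

end ViscousHJ

theorem lemma3p3 {Ω : Type*} [MeasurableSpace Ω] (P : Measure Ω) [IsProbabilityMeasure P]
    (τ : ℝ → Ω → Ω) (hτ : ViscousHJ.IsErgodicAction P τ)
    (κ : ℝ) (hκ : 0 < κ) (a : ℝ → Ω → ℝ) (ha : ViscousHJ.IsDiffusionCoefficient P τ κ a)
    (α₀ α₁ γ : ℝ) (hα₀ : 0 < α₀) (hα₁ : 0 < α₁) (hγ : 2 < γ)
    (H : ℝ → ℝ → Ω → ℝ) (hH : ViscousHJ.IsStationaryHamiltonian τ H)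
    (hHclass : ViscousHJ.InHamiltonianClass α₀ α₁ γ H) :
    (∀ ω, (ViscousHJ.supersolutionLevels (fun x => a x ω) (fun x p => H x p ω)).Nonempty ∧
      BddBelow (ViscousHJ.supersolutionLevels (fun x => a x ω) (fun x p => H x p ω))) ∧
    Measurable (ViscousHJ.criticalValue a H) ∧
    (∀ y ω, ViscousHJ.criticalValue a H (τ y ω) = ViscousHJ.criticalValue a H ω) ∧
    ∃ c : ℝ, ∀ᵐ ω ∂P, ViscousHJ.criticalValue a H ω = c := by
  have hne : ∀ ω, (ViscousHJ.supersolutionLevels (fun x => a x ω)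
      (fun x p => H x p ω)).Nonempty := fun ω =>
    ⟨α₁, _, ViscousHJ.isViscositySupersolution_zero (fun x => (ha.mem_Icc x ω).1) fun x => by
      simpa [Real.zero_rpow (show γ ≠ 0 by linarith)] using hHclass.upper x 0 ω⟩
  have hbdd : ∀ ω, BddBelow (ViscousHJ.supersolutionLevels (fun x => a x ω)
      (fun x p => H x p ω)) := fun ω =>
    ViscousHJ.bddBelow_supersolutionLevels hα₀ hγ.le (fun x => ha.mem_Icc x ω)
      fun x p => hHclass.lower x p ω
  have hmeas : Measurable (ViscousHJ.criticalValue a H) := by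
    refine measurable_of_Iio fun r => ?_
    -- Levels are upward closed, so rational ones detect the infimum.
    have hset : ViscousHJ.criticalValue a H ⁻¹' Set.Iio r = ⋃ (q : ℚ) (_ : (q : ℝ) < r),
        {ω | (q : ℝ) ∈ ViscousHJ.supersolutionLevels (fun x => a x ω) fun x p => H x p ω} := by
      ext ω
      simp only [Set.mem_preimage, Set.mem_Iio, Set.mem_iUnion, Set.mem_ofPred_eq, exists_prop]
      constructor
      · intro h
        obtain ⟨l, ⟨u, hu⟩, hlr⟩ := exists_lt_of_csInf_lt (hne ω) h
        obtain ⟨q, hlq, hqr⟩ := exists_rat_btwn hlr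
        exact ⟨q, hqr, u, hu.mono hlq.le⟩
      · rintro ⟨q, hqr, hq⟩
        exact (csInf_le (hbdd ω) hq).trans_lt hqr
    rw [hset]
    exact MeasurableSet.iUnion fun q => MeasurableSet.iUnion fun _ =>
      ViscousHJ.measurableSet_mem_supersolutionLevels ha hH hHclass hα₀ hγ.le q
  have hstat : ∀ y ω, ViscousHJ.criticalValue a H (τ y ω) = ViscousHJ.criticalValue a H ω :=
    fun y ω => congrArg sInf (ViscousHJ.supersolutionLevels_shift hτ ha hH y ω)
  exact ⟨fun ω => ⟨hne ω, hbdd ω⟩, hmeas, hstat,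
    hτ.ergodic _ hmeas fun x => Filter.Eventually.of_forall (hstat x)⟩
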